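/- Let $\mathbf{k}$ be a field and let $\mathcal{D}$ be a $\mathbf{k}$-linear triangulated category that is of finite type (i.e. $\bigoplus_{i}\mathrm{Hom}(X,Y[i])$ is finite-dimensional for all objects $X,Y$) and saturated (i.e. every covariant and every contravariant $\mathbf{k}$-linear cohomological functor $H$ from $\mathcal{D}$ to $\mathbf{k}$-vector spaces with $\bigoplus_i H(X[i])$ finite-dimensional for all $X$ is representable). For objects $E_1,E_2$ of $\mathcal D$ and $t\in\mathbb R$, let $\delta_t(E_1,E_2)\in[0,\infty]$ be $0$ if $E_2\cong 0$, and otherwise the infimum of the sums $\sum_{k=1}^m e^{n_kt}$ over all sequences $0=A_0\to A_1\to\cdots\to A_m\cong E_2\oplus E'$ (with $E'$ any object) such that $\mathrm{Cone}(A_{k-1}\to A_k)\cong E_1[n_k]$ for all $k$ (with $\inf\emptyset=\infty$). A split generator of $\mathcal D$ is an object $G$ with $\delta_t(G,E)<\infty$ for all objects $E$ and all $t$. Let $G$ be a split generator of $\mathcal D$. Fix a homomorphism $\mathrm{cl}\colon K_0(\mathcal D)\to\Gamma$ to a free abelian group $\Gamma$ of finite rank. A Bridgeland stability condition $\sigma=(Z,P)$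 (with respect to $\mathrm{cl}$) consists of a homomorphism $Z\colon\Gamma\to\mathbb C$, also written $Z(E)=Z(\mathrm{cl}[E])$, and full additive subcategories $P(\phi)\subseteq\mathcal D$, closed under isomorphism, for $\phi\in\mathbb R$, such that: $Z(E)\in\mathbb R_{>0}e^{i\pi\phi}$ for $0\ne E\in P(\phi)$; $P(\phi+1)=P(\phi)[1]$; $\mathrm{Hom}(E_1,E_2)=0$ if $E_i\in P(\phi_i)$ and $\phi_1>\phi_2$; every object has a finite Harder--Narasimhan filtration with factors in $P(\phi_1),\dots,P(\phi_n)$, $\phi_1>\cdots>\phi_n$; and there are $C>0$ and a norm on $\Gamma\otimes\mathbb R$ with $\|\mathrm{cl}[E]\|\le C|Z(E)|$ for all $\phi$ and all $0\neq E\in P(\phi)$. Let $\widetilde{\mathrm{GL}}{}_2^+(\mathbb R)$ be the group of pairs $(T,f)$ with $T\in \mathrm{GL}_2^+(\mathbb R)$ and $f\colon\mathbb R\to\mathbb R$ an increasing map with $f(\phi+1)=f(\phi)+1$, such that $T$ and $f$ induce the same map on $(\mathbb R^2\setminus\{0\})/\mathbb R_{>0}\cong\mathbb R/2\mathbb Z$,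 where $\phi\in\mathbb R/2\mathbb Z$ corresponds to the ray spanned by $(\cos\pi\phi,\sin\pi\phi)$. Let $F$ be a $\mathbf{k}$-linear triangulated autoequivalence of $\mathcal D$, no power of which is the zero functor (equivalently, $\mathcal D\neq0$). Put $F\cdot\sigma=(Z\circ F^{-1},\ \phi\mapsto F(P(\phi)))$ and $\sigma\cdot(T,f)=(T^{-1}\circ Z,\ \phi\mapsto P(f(\phi)))$, where central charges are regarded as homomorphisms $K_0(\mathcal D)\to\mathbb C=\mathbb R^2$. Assume that $F$ is pseudo-Anosov in the sense of Dimitrov, Haiden, Katzarkov and Kontsevich, that is, there are a Bridgeland stability condition $\sigma$ and $(T,f)\in\widetilde{\mathrm{GL}}{}_2^+(\mathbb R)$ with $$F\cdot\sigma=\sigma\cdot(T,f),\qquad T=\begin{pmatrix}r&0\\0&r^{-1}\end{pmatrix}\text{ or }\begin{pmatrix}r^{-1}&0\\0&r\end{pmatrix}\text{ for some real } r \text{ with } |r|>1.$$ Then, for every such $\sigma$ and $(T,f)$, the following holds. For all $n\ge0$ the numbers $$\varepsilon^+_n=\max\{j\in\mathbb Z:\mathrm{Hom}(G,F^nG[-j])\ne0\},\qquad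 \varepsilon^-_n=\min\{j\in\mathbb Z:\mathrm{Hom}(G,F^nG[-j])\neq0\}$$ exist; the limits $\tau^\pm(F)=\lim_{n\to\infty}\varepsilon_n^\pm/n$ (the upper and lower shifting numbers of $F$) exist; and, with $\tau(F)=\tfrac12(\tau^+(F)+\tau^-(F))$, $$\tau(F)=\tau^+(F)=\tau^-(F)=\tilde\rho(f)=f(0)\in\mathbb Z,$$ where $\tilde\rho(f)=\lim_{n\to\infty}(f^n(x_0)-x_0)/n$ (for any $x_0\in\mathbb R$) is the Poincaré translation number of $f$. -/

import Mathlib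

open CategoryTheory Limits Pretriangulated Filter Topology
open scoped ZeroObject TensorProduct ENNReal MatrixGroups

universe w v u z

namespace ShiftingNumbers


noncomputable section

/-! ### Standing conventions on triangulated categories -/

section Conventions

variable (k : Type w) [Field k] (D : Type u) [Category.{v} D] [Preadditive D] [Linear k D]

/-- A `k`-linear triangulated category is of finite type if the total Hom-space
`⨁ i, Hom(X, Y[i])` is finite dimensional for all objects `X`, `Y`. -/
def IsFiniteType [HasShift D ℤ] : Prop :=
  ∀ X Y : D, Module.Finite k (DirectSum ℤ fun i => (X ⟶ Y⟦i⟧))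

variable [HasZeroObject D] [HasShift D ℤ] [∀ n : ℤ, (shiftFunctor D n).Additive]
  [Pretriangulated D]

/-- A contravariant `k`-linear functor to `k`-vector spaces is cohomological of finite type if it
sends distinguished triangles to exact sequences and `⨁ i, H(X[i])` is finite dimensional for
every object `X`. -/
structure IsFiniteTypeContravariant (H : Dᵒᵖ ⥤ ModuleCat.{v} k) : Prop where
  map_add : ∀ {X Y : D} (a b : X ⟶ Y), H.map (a + b).op = H.map a.op + H.map b.op
  map_smul : ∀ {X Y : D} (c : k) (a : X ⟶ Y), H.map (c • a).op = c • H.map a.op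
  exact : ∀ T ∈ (distTriang D),
    Function.Exact (H.map T.mor₂.op).hom (H.map T.mor₁.op).hom
  finite : ∀ X : D, Module.Finite k (DirectSum ℤ fun i => H.obj (Opposite.op (X⟦i⟧)))

/-- The covariant version of `IsFiniteTypeContravariant`. -/
structure IsFiniteTypeCovariant (H : D ⥤ ModuleCat.{v} k) : Prop where
  map_add : ∀ {X Y : D} (a b : X ⟶ Y), H.map (a + b) = H.map a + H.map b
  map_smul : ∀ {X Y : D} (c : k) (a : X ⟶ Y), H.map (c • a) = c • H.map a
  exact : ∀ T ∈ (distTriang D),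
    Function.Exact (H.map T.mor₁).hom (H.map T.mor₂).hom
  finite : ∀ X : D, Module.Finite k (DirectSum ℤ fun i => H.obj (X⟦i⟧))

/-- A `k`-linear triangulated category is saturated (Bondal-Kapranov) if every contravariant and
every covariant cohomological functor of finite type to `k`-vector spaces is representable. -/
structure IsSaturated : Prop where
  representable : ∀ H : Dᵒᵖ ⥤ ModuleCat.{v} k, IsFiniteTypeContravariant k D H →
    ∃ Y : D, Nonempty ((linearYoneda k D).obj Y ≅ H)
  corepresentable : ∀ H : D ⥤ ModuleCat.{v} k, IsFiniteTypeCovariant k D H →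
    ∃ X : D, Nonempty ((linearCoyoneda k D).obj (Opposite.op X) ≅ H)

end Conventions

/-- An endofunctor is virtually zero if some power of it is the zero functor. -/
def IsVirtuallyZero {D : Type u} [Category.{v} D] (F : D ⥤ D) : Prop :=
  ∃ n : ℕ, ∀ X : D, IsZero (F.obj^[n] X)

variable {D : Type u} [Category.{v} D] [Preadditive D] [HasZeroObject D] [HasShift D ℤ]
  [∀ n : ℤ, (shiftFunctor D n).Additive] [Pretriangulated D]

/-! ### Complexity, split generators and shifting numbers -/

/-- A tower `0 = A₀ ⟶ A₁ ⟶ ⋯ ⟶ Aₘ` such that the cone of `Aⱼ ⟶ Aⱼ₊₁` is `E[nⱼ]`. -/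
def IsTower (E : D) {m : ℕ} (n : Fin m → ℤ) (A : Fin (m + 1) → D) : Prop :=
  IsZero (A 0) ∧ ∀ j : Fin m,
    ∃ (a : A j.castSucc ⟶ A j.succ) (b : A j.succ ⟶ E⟦n j⟧)
      (c : E⟦n j⟧ ⟶ (A j.castSucc)⟦(1 : ℤ)⟧), Triangle.mk a b c ∈ (distTriang D)

open Classical in
/-- The complexity `δ_t(E₁, E₂)`. The infimum is over the empty set, hence `∞`, when `E₂` is not
in the thick subcategory generated by `E₁`. -/
def complexity (t : ℝ) (E₁ E₂ : D) : ℝ≥0∞ :=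
  if IsZero E₂ then 0 else
    sInf {s : ℝ≥0∞ | ∃ (m : ℕ) (n : Fin m → ℤ) (A : Fin (m + 1) → D) (E' : D),
      IsTower E₁ n A ∧ Nonempty (A (Fin.last m) ≅ E₂ ⊞ E') ∧
        s = ∑ j, ENNReal.ofReal (Real.exp (n j * t))}

/-- `G` is a split generator if `δ_t(G, E)` is finite for every object `E`. -/
def IsSplitGenerator (G : D) : Prop :=
  ∀ (E : D) (t : ℝ), complexity t G E < ∞

/-- The degrees `j` such that `Hom(E₁, E₂[-j]) ≠ 0`. -/
def extDegrees (E₁ E₂ : D) : Set ℤ :=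
  {j : ℤ | ∃ a : E₁ ⟶ E₂⟦-j⟧, a ≠ 0}

/-- `τ` is the upper shifting number of `F`, computed with `G`: the numbers
`ε⁺(G, Fⁿ G) = max {j | Hom(G, Fⁿ G[-j]) ≠ 0}` exist and `ε⁺(G, Fⁿ G) / n ⟶ τ`. -/
def HasUpperShiftingNumber (F : D ⥤ D) (G : D) (τ : ℝ) : Prop :=
  ∃ ε : ℕ → ℤ, (∀ n, IsGreatest (extDegrees G (F.obj^[n] G)) (ε n)) ∧
    Tendsto (fun n : ℕ => (ε n : ℝ) / n) atTop (𝓝 τ)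

/-- `τ` is the lower shifting number of `F`, computed with `G`: the numbers
`ε⁻(G, Fⁿ G) = min {j | Hom(G, Fⁿ G[-j]) ≠ 0}` exist and `ε⁻(G, Fⁿ G) / n ⟶ τ`. -/
def HasLowerShiftingNumber (F : D ⥤ D) (G : D) (τ : ℝ) : Prop :=
  ∃ ε : ℕ → ℤ, (∀ n, IsLeast (extDegrees G (F.obj^[n] G)) (ε n)) ∧
    Tendsto (fun n : ℕ => (ε n : ℝ) / n) atTop (𝓝 τ)

/-- `τ` is the shifting number of `F`: the average of the upper and lower shifting numbers. -/
def HasShiftingNumber (F : D ⥤ D) (G : D) (τ : ℝ) : Prop :=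
  ∃ τp τm : ℝ, HasUpperShiftingNumber F G τp ∧ HasLowerShiftingNumber F G τm ∧
    τ = (τp + τm) / 2

/-! ### The Grothendieck group -/

variable (D) in
/-- The relations `[T.obj₂] = [T.obj₁] + [T.obj₃]` for distinguished triangles `T`. -/
def k0Relations : AddSubgroup (FreeAbelianGroup D) :=
  AddSubgroup.closure {x | ∃ T ∈ (distTriang D),
    x = FreeAbelianGroup.of T.obj₂ - FreeAbelianGroup.of T.obj₁ - FreeAbelianGroup.of T.obj₃}

variable (D) in
/-- The Grothendieck group `K₀(D)` of a triangulated category. -/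
abbrev K0 : Type u := FreeAbelianGroup D ⧸ k0Relations D

/-- The class `[E]` of an object in `K₀(D)`. -/
def K0.cls (E : D) : K0 D := QuotientAddGroup.mk (FreeAbelianGroup.of E)

/-- The endomorphism `[E] ↦ [F E]` of `K₀(D)` induced by a triangulated functor. -/
def K0.map (F : D ⥤ D) [F.CommShift ℤ] [F.IsTriangulated] : K0 D →+ K0 D :=
  QuotientAddGroup.map _ _ (FreeAbelianGroup.map F.obj) (by
    rw [k0Relations, AddSubgroup.closure_le]
    rintro x ⟨T, hT, rfl⟩
    refine AddSubgroup.subset_closure ⟨_, F.map_distinguished T hT, ?_⟩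
    simp)

@[simp]
lemma K0.map_cls (F : D ⥤ D) [F.CommShift ℤ] [F.IsTriangulated] (E : D) :
    K0.map F (K0.cls E) = K0.cls (F.obj E) := by
  simp [K0.map, K0.cls]

/-! ### Bridgeland stability conditions -/

variable {Γ : Type*} [AddCommGroup Γ]

/-- A Bridgeland stability condition with respect to `cl : K₀(D) → Γ`. -/
structure StabilityCondition (cl : K0 D →+ Γ) where
  /-- the central charge -/
  Z : Γ →+ ℂ
  /-- the semistable objects of phase `φ`, a full additive subcategory -/
  P : ℝ → ObjectProperty D
  closedUnderIso : ∀ φ, (P φ).IsClosedUnderIsomorphisms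
  zero_mem : ∀ φ (E : D), IsZero E → P φ E
  biprod_mem : ∀ φ (E E' : D), P φ E → P φ E' → P φ (E ⊞ E')
  charge : ∀ φ (E : D), P φ E → ¬ IsZero E →
    ∃ m : ℝ, 0 < m ∧ Z (cl (K0.cls E)) = m * Complex.exp (Complex.I * Real.pi * φ)
  shift : ∀ φ, P (φ + 1) = (P φ).map (shiftFunctor D (1 : ℤ))
  hom_eq_zero : ∀ (φ₁ φ₂ : ℝ) (E₁ E₂ : D), P φ₁ E₁ → P φ₂ E₂ → φ₂ < φ₁ →
    ∀ a : E₁ ⟶ E₂, a = 0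
  /-- existence of Harder-Narasimhan filtrations -/
  harderNarasimhan : ∀ E : D, ∃ (n : ℕ) (X : Fin (n + 1) → D) (A : Fin n → D) (φ : Fin n → ℝ),
    IsZero (X 0) ∧ Nonempty (X (Fin.last n) ≅ E) ∧ StrictAnti φ ∧
      ∀ i : Fin n, P (φ i) (A i) ∧
        ∃ (a : X i.castSucc ⟶ X i.succ) (b : X i.succ ⟶ A i)
          (c : A i ⟶ (X i.castSucc)⟦(1 : ℤ)⟧), Triangle.mk a b c ∈ (distTriang D)
  /-- the support property; `N` is a norm on `Γ ⊗ ℝ` -/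
  support : ∃ (C : ℝ) (N : Seminorm ℝ (ℝ ⊗[ℤ] Γ)), 0 < C ∧ (∀ x, N x = 0 → x = 0) ∧
    ∀ φ (E : D), P φ E → ¬ IsZero E →
      N ((1 : ℝ) ⊗ₜ[ℤ] cl (K0.cls E)) ≤ C * ‖Z (cl (K0.cls E))‖

/-- The underlying data `(Z, P)` of a stability condition, with the central charge regarded as a
homomorphism on `K₀(D)`. -/
@[ext]
structure ChargeAndSlices (D : Type u) [Category.{v} D] [Preadditive D] [HasZeroObject D]
    [HasShift D ℤ] [∀ n : ℤ, (shiftFunctor D n).Additive] [Pretriangulated D] where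
  /-- the central charge -/
  Z : K0 D →+ ℂ
  /-- the semistable objects of each phase -/
  P : ℝ → ObjectProperty D

/-! ### The actions of autoequivalences and of the universal cover of `GL₂⁺(ℝ)` -/

/-- An element `(T, f)` of the universal cover of `GL₂⁺(ℝ)`: a matrix `T` of positive determinant
and an increasing map `f : ℝ → ℝ` with `f (φ + 1) = f φ + 1` that induce the same map on
`(ℝ² ∖ 0) / ℝ_{>0} ≅ ℝ / 2ℤ`, where `φ` corresponds to the ray of `(cos πφ, sin πφ)`. Monotonicity
of `f` (as in `CircleDeg1Lift`) is automatically strict, because `T` is injective on rays. -/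
structure GLTilde where
  T : GL(2, ℝ)⁺
  f : CircleDeg1Lift
  compat : ∀ φ : ℝ, ∃ c : ℝ, 0 < c ∧
    ((T : GL (Fin 2) ℝ) : Matrix (Fin 2) (Fin 2) ℝ).mulVec ![Real.cos (Real.pi * φ), Real.sin (Real.pi * φ)] =
      c • ![Real.cos (Real.pi * f φ), Real.sin (Real.pi * f φ)]

/-- The action of a real `2 × 2` matrix on `ℂ = ℝ²`. -/
def matrixOnComplex (M : Matrix (Fin 2) (Fin 2) ℝ) : ℂ →+ ℂ where
  toFun z := ⟨M 0 0 * z.re + M 0 1 * z.im, M 1 0 * z.re + M 1 1 * z.im⟩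
  map_zero' := by apply Complex.ext <;> simp
  map_add' z z' := by apply Complex.ext <;> simp <;> ring

/-- `F · σ = (Z ∘ F⁻¹, φ ↦ F(P φ))`. -/
def autAct {cl : K0 D →+ Γ} (F : D ≌ D) [F.functor.CommShift ℤ] [F.inverse.CommShift ℤ]
    [F.CommShift ℤ] [F.IsTriangulated] (σ : StabilityCondition cl) : ChargeAndSlices D where
  Z := (σ.Z.comp cl).comp (K0.map F.inverse)
  P φ := (σ.P φ).map F.functor

/-- `σ · (T, f) = (T⁻¹ ∘ Z, φ ↦ P (f φ))`. -/
def glAct {cl : K0 D →+ Γ} (σ : StabilityCondition cl) (g : GLTilde) : ChargeAndSlices D where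
  Z := (matrixOnComplex (((g.T⁻¹ : GL(2, ℝ)⁺) : GL (Fin 2) ℝ) : Matrix (Fin 2) (Fin 2) ℝ)).comp
    (σ.Z.comp cl)
  P φ := σ.P (g.f φ)

/-- `T` is `diag(r, r⁻¹)` or `diag(r⁻¹, r)` with `|r| > 1`. -/
def IsHyperbolicDiagonal (T : Matrix (Fin 2) (Fin 2) ℝ) : Prop :=
  ∃ r : ℝ, 1 < |r| ∧ (T = !![r, 0; 0, r⁻¹] ∨ T = !![r⁻¹, 0; 0, r])

/-- The stability condition `σ` and the element `g = (T, f)` exhibit the autoequivalence `F` as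
pseudo-Anosov; `F` is pseudo-Anosov if such `σ` and `g` exist. -/
structure IsPseudoAnosovVia {cl : K0 D →+ Γ} (F : D ≌ D) [F.functor.CommShift ℤ]
    [F.inverse.CommShift ℤ] [F.CommShift ℤ] [F.IsTriangulated]
    (σ : StabilityCondition cl) (g : GLTilde) : Prop where
  act_eq : autAct F σ = glAct σ g
  hyperbolic : IsHyperbolicDiagonal ((g.T : GL (Fin 2) ℝ) : Matrix (Fin 2) (Fin 2) ℝ)

end

end ShiftingNumbers

namespace ShiftingNumbers

/-! A diagonal `T` preserves the horizontal axis, so `f 0` is an integer `m`, and then `f c = c + m`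
at every integer `c`. If the semistable factors of `G` have phases in `[a, b]` with integer ends,
those of `Fⁿ G` have phases in `[a + nm, b + nm]`. Since there are no maps from larger to smaller
phases, `Hom(G, Fⁿ G[-j]) ≠ 0` forces `j - nm ≤ b - a`. Saturation gives a Serre dual `S` of `G`
(`IsSaturated.exists_serre_dual`), so the same Hom also forces a nonzero map `Fⁿ G[-j] ⟶ S`; if `S`
has phases in `[a', b']`, then `j - nm ≥ a - b'`. Thus all degrees lie within a bounded distance of
`nm`, and dividing by `n` gives both limits. -/

lemma tendsto_div_of_abs_sub_le {ε : ℕ → ℤ} {m C : ℤ}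
    (h : ∀ n : ℕ, |ε n - n * m| ≤ C) :
    Tendsto (fun n : ℕ => (ε n : ℝ) / n) atTop (𝓝 m) := by
  rw [tendsto_iff_norm_sub_tendsto_zero]
  refine squeeze_zero' (Eventually.of_forall fun _ => norm_nonneg _) ?_
    (tendsto_const_div_atTop_nhds_zero_nat (C : ℝ))
  filter_upwards [eventually_gt_atTop 0] with n hn
  have hn' : (0 : ℝ) < n := by exact_mod_cast hn
  have h' : |(ε n : ℝ) - n * m| ≤ C := by exact_mod_cast h n
  rw [Real.norm_eq_abs, le_div_iff₀ hn', ← abs_of_pos hn', ← abs_mul, abs_of_pos hn', sub_mul,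
    div_mul_cancel₀ _ hn'.ne', mul_comm (m : ℝ)]
  exact h'

lemma hasShiftingNumbers_of_extDegrees_subset {D : Type u} [Category.{v} D] [Preadditive D]
    [HasShift D ℤ] (F : D ⥤ D) (G : D) {m C : ℤ}
    (hne : ∀ n : ℕ, (extDegrees G (F.obj^[n] G)).Nonempty)
    (hC : ∀ n : ℕ, ∀ j ∈ extDegrees G (F.obj^[n] G), |j - n * m| ≤ C) :
    HasUpperShiftingNumber F G m ∧ HasLowerShiftingNumber F G m := by
  have hmax : ∀ n : ℕ, ∃ j, IsGreatest (extDegrees G (F.obj^[n] G)) j := fun n =>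
    BddAbove.exists_isGreatest_of_nonempty
      ⟨n * m + C, fun j hj => by have := abs_le.1 (hC n j hj); linarith⟩ (hne n)
  have hmin : ∀ n : ℕ, ∃ j, IsLeast (extDegrees G (F.obj^[n] G)) j := fun n =>
    BddBelow.exists_isLeast_of_nonempty
      ⟨n * m - C, fun j hj => by have := abs_le.1 (hC n j hj); linarith⟩ (hne n)
  choose ε hε using hmax
  choose ε' hε' using hmin
  exact ⟨⟨ε, hε, tendsto_div_of_abs_sub_le fun n => hC n _ (hε n).1⟩,
    ⟨ε', hε', tendsto_div_of_abs_sub_le fun n => hC n _ (hε' n).1⟩⟩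

/-! ### A Serre dual of an object, from saturation. -/

section Serre

variable {k : Type w} [Field k] {D : Type u} [Category.{v} D] [Preadditive D] [Linear k D]

lemma nonempty_linearEquiv_dual (M : Type v) [AddCommGroup M] [Module k M] [Module.Finite k M] :
    Nonempty (Module.Dual k M ≃ₗ[k] M) :=
  ⟨(Module.finBasis k M).toDualEquiv.symm⟩

/-- The dual lives in `Type (max v w)`, whereas saturation concerns functors to `ModuleCat.{v} k`;
finite dimension allows shrinking it. -/
instance small_dual (M : Type v) [AddCommGroup M] [Module k M] [Module.Finite k M] :
    Small.{v} (Module.Dual k M) :=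
  ⟨M, ⟨(nonempty_linearEquiv_dual M).some.toEquiv⟩⟩

section DualMap

variable (G : D) [∀ X : D, Module.Finite k (G ⟶ X)]

variable (k) in
/-- The dual of `Hom(G, X)`, in the universe of the Hom-spaces. -/
abbrev HomDual (X : D) : Type v := Shrink.{v} (Module.Dual k (G ⟶ X))

variable (k) in
/-- The evaluation pairing of `HomDual k G X` and `Hom(G, X)`. -/
noncomputable def homDualEquiv (X : D) : HomDual k G X ≃ₗ[k] Module.Dual k (G ⟶ X) :=
  Shrink.linearEquiv k _

variable (k) in
/-- The transpose of `Hom(G, X) ⟶ Hom(G, Y)`. -/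
noncomputable def homDualMap {X Y : D} (a : X ⟶ Y) : HomDual k G Y →ₗ[k] HomDual k G X :=
  (homDualEquiv k G X).symm.toLinearMap ∘ₗ (Linear.rightComp k G a).dualMap ∘ₗ
    (homDualEquiv k G Y).toLinearMap

variable {G}

lemma homDual_ext {X : D} {x x' : HomDual k G X}
    (h : ∀ y, homDualEquiv k G X x y = homDualEquiv k G X x' y) : x = x' :=
  (homDualEquiv k G X).injective (LinearMap.ext h)

lemma homDualEquiv_homDualMap {X Y : D} (a : X ⟶ Y) (x : HomDual k G Y) (y : G ⟶ X) :
    homDualEquiv k G X (homDualMap k G a x) y = homDualEquiv k G Y x (y ≫ a) := by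
  simp only [homDualMap, LinearMap.comp_apply, LinearEquiv.coe_coe, LinearEquiv.apply_symm_apply,
    LinearMap.dualMap_apply, Linear.rightComp_apply]

lemma homDualMap_id (X : D) : homDualMap k G (𝟙 X) = LinearMap.id :=
  LinearMap.ext fun x => homDual_ext fun y => by
    rw [homDualEquiv_homDualMap, Category.comp_id, LinearMap.id_apply]

lemma homDualMap_comp {X Y Z : D} (a : X ⟶ Y) (b : Y ⟶ Z) :
    homDualMap k G (a ≫ b) = homDualMap k G a ∘ₗ homDualMap k G b :=
  LinearMap.ext fun x => homDual_ext fun y => by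
    simp only [homDualEquiv_homDualMap, LinearMap.comp_apply, Category.assoc]

lemma homDualMap_add {X Y : D} (a b : X ⟶ Y) :
    homDualMap k G (a + b) = homDualMap k G a + homDualMap k G b :=
  LinearMap.ext fun x => homDual_ext fun y => by
    simp only [homDualEquiv_homDualMap, LinearMap.add_apply, map_add, Preadditive.comp_add]

lemma homDualMap_smul {X Y : D} (c : k) (a : X ⟶ Y) :
    homDualMap k G (c • a) = c • homDualMap k G a :=
  LinearMap.ext fun x => homDual_ext fun y => by
    simp only [homDualEquiv_homDualMap, LinearMap.smul_apply, _root_.map_smul, Linear.comp_smul]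

variable (k G) in
/-- The contravariant functor `X ↦ Hom(G, X)^*`. -/
noncomputable def dualCoyoneda : Dᵒᵖ ⥤ ModuleCat.{v} k where
  obj X := ModuleCat.of k (HomDual k G X.unop)
  map a := ModuleCat.ofHom (homDualMap k G a.unop)
  map_id X := congrArg ModuleCat.ofHom (homDualMap_id X.unop)
  map_comp a b := congrArg ModuleCat.ofHom (homDualMap_comp b.unop a.unop)

end DualMap

variable [HasShift D ℤ]

lemma IsFiniteType.finite_hom (h : IsFiniteType k D) (X Y : D) : Module.Finite k (X ⟶ Y) := by
  have := h X Y
  have h0 : Module.Finite k (X ⟶ Y⟦(0 : ℤ)⟧) :=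
    Module.Finite.of_surjective
      (DirectSum.component k ℤ (fun i => (X ⟶ Y⟦i⟧)) 0) fun x =>
        ⟨DirectSum.lof k ℤ (fun i => (X ⟶ Y⟦i⟧)) 0 x, DirectSum.component.lof_self ..⟩
  exact Module.Finite.equiv
    (Linear.homCongr k (Iso.refl X) ((shiftFunctorZero D ℤ).app Y))

variable [HasZeroObject D] [∀ n : ℤ, (shiftFunctor D n).Additive] [Pretriangulated D]

/-- `Hom(G, -)` is exact at the middle term of a triangle, and over a field transposition preserves
exactness: kernels and ranges of transposes are annihilators of ranges and kernels. -/
lemma exact_homDualMap (G : D) [∀ X : D, Module.Finite k (G ⟶ X)] (T : Triangle D)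
    (hT : T ∈ (distTriang D)) :
    Function.Exact (homDualMap k G T.mor₂) (homDualMap k G T.mor₁) := by
  have hexact : LinearMap.ker (Linear.rightComp k G T.mor₂) =
      LinearMap.range (Linear.rightComp k G T.mor₁) := by
    ext y
    constructor
    · intro hy
      obtain ⟨z, hz⟩ := Triangle.coyoneda_exact₂ T hT y hy
      exact ⟨z, hz.symm⟩
    · rintro ⟨z, rfl⟩
      simp [comp_distTriang_mor_zero₁₂ _ hT]
  have hdual : LinearMap.ker (Linear.rightComp k G T.mor₁).dualMap =
      LinearMap.range (Linear.rightComp k G T.mor₂).dualMap := by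
    rw [LinearMap.ker_dualMap_eq_dualAnnihilator_range,
      LinearMap.range_dualMap_eq_dualAnnihilator_ker, hexact]
  intro x
  constructor
  · intro hx
    have hmem : homDualEquiv k G _ x ∈ LinearMap.ker (Linear.rightComp k G T.mor₁).dualMap := by
      rw [LinearMap.mem_ker]
      ext y
      have := homDualEquiv_homDualMap T.mor₁ x y
      rw [hx, map_zero] at this
      exact this.symm
    rw [hdual] at hmem
    obtain ⟨z, hz⟩ := hmem
    refine ⟨(homDualEquiv k G T.obj₃).symm z, homDual_ext fun y => ?_⟩
    rw [homDualEquiv_homDualMap, LinearEquiv.apply_symm_apply, ← hz]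
    rfl
  · rintro ⟨z, rfl⟩
    refine homDual_ext fun y => ?_
    rw [homDualEquiv_homDualMap, homDualEquiv_homDualMap, Category.assoc,
      comp_distTriang_mor_zero₁₂ _ hT, comp_zero, map_zero, map_zero, LinearMap.zero_apply]

lemma isFiniteTypeContravariant_dualCoyoneda (h : IsFiniteType k D) (G : D)
    [∀ X : D, Module.Finite k (G ⟶ X)] :
    IsFiniteTypeContravariant k D (dualCoyoneda k G) where
  map_add a b := congrArg ModuleCat.ofHom (homDualMap_add a b)
  map_smul c a := congrArg ModuleCat.ofHom (homDualMap_smul c a)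
  exact T hT := exact_homDualMap G T hT
  finite X := by
    have : Module.Finite k (Π₀ i : ℤ, (G ⟶ X⟦i⟧)) := h G X
    exact Module.Finite.equiv (DFinsupp.mapRange.linearEquiv fun i : ℤ =>
      ((homDualEquiv k G (X⟦i⟧)).trans
        (nonempty_linearEquiv_dual (k := k) (G ⟶ X⟦i⟧)).some).symm)

/-- In a saturated category of finite type, the functor `Hom(G, -)^*` is represented by an
object `S`; in particular `Hom(X, S) = 0` implies `Hom(G, X) = 0`. -/
lemma IsSaturated.exists_serre_dual (hsat : IsSaturated k D) (h : IsFiniteType k D) (G : D) :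
    ∃ S : D, ∀ X : D, (∀ a : X ⟶ S, a = 0) → ∀ b : G ⟶ X, b = 0 := by
  have := fun X => h.finite_hom G X
  obtain ⟨S, ⟨e⟩⟩ := hsat.representable _ (isFiniteTypeContravariant_dualCoyoneda h G)
  refine ⟨S, fun X hX b => ?_⟩
  -- Functionals separate vectors, and each functional on `Hom(G, X)` comes from a map `X ⟶ S`,
  -- hence is zero.
  rw [← Module.forall_dual_apply_eq_zero_iff k]
  intro l
  let e' : (X ⟶ S) ≃ₗ[k] HomDual k G X := (e.app (Opposite.op X)).toLinearEquiv
  have hl : (homDualEquiv k G X).symm l = 0 := by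
    rw [← e'.apply_symm_apply ((homDualEquiv k G X).symm l), hX (e'.symm _), map_zero]
  rw [LinearEquiv.map_eq_zero_iff] at hl
  rw [hl, LinearMap.zero_apply]

end Serre

variable {D : Type u} [Category.{v} D] [Preadditive D] [HasZeroObject D] [HasShift D ℤ]
  [∀ n : ℤ, (shiftFunctor D n).Additive] [Pretriangulated D]

/-! ### Objects filtered by a class of objects -/

/-- The objects with a finite filtration whose factors satisfy `Q`. -/
inductive FilteredBy (Q : ObjectProperty D) : D → Prop
  | zero (X : D) : IsZero X → FilteredBy Q X
  | extension (T : Triangle D) : T ∈ (distTriang D) → FilteredBy Q T.obj₁ → Q T.obj₃ →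
      FilteredBy Q T.obj₂
  | of_iso (X Y : D) : (X ≅ Y) → FilteredBy Q X → FilteredBy Q Y

namespace FilteredBy

variable {Q R : ObjectProperty D}

lemma hom_eq_zero_of_left {X Y : D} (hX : FilteredBy Q X)
    (h : ∀ A, Q A → ∀ a : A ⟶ Y, a = 0) (a : X ⟶ Y) : a = 0 := by
  induction hX with
  | zero X hX => exact hX.eq_of_src _ _
  | extension T hT _ h₃ ih =>
    obtain ⟨b, rfl⟩ := Triangle.yoneda_exact₂ T hT a (ih _)
    rw [h _ h₃ b, comp_zero]
  | of_iso X X' e _ ih => rw [← cancel_epi e.hom, ih (e.hom ≫ a), comp_zero]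

lemma hom_eq_zero_of_right {X Y : D} (hY : FilteredBy R Y)
    (h : ∀ B, R B → ∀ a : X ⟶ B, a = 0) (a : X ⟶ Y) : a = 0 := by
  induction hY with
  | zero Y hY => exact hY.eq_of_tgt _ _
  | extension T hT _ h₃ ih =>
    obtain ⟨b, rfl⟩ := Triangle.coyoneda_exact₂ T hT a (h _ h₃ _)
    rw [ih b, zero_comp]
  | of_iso Y Y' e _ ih => rw [← cancel_mono e.inv, ih (a ≫ e.inv), zero_comp]

lemma hom_eq_zero {X Y : D} (hX : FilteredBy Q X) (hY : FilteredBy R Y)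
    (h : ∀ A B, Q A → R B → ∀ a : A ⟶ B, a = 0) (a : X ⟶ Y) : a = 0 :=
  hX.hom_eq_zero_of_left (fun _ hA => hY.hom_eq_zero_of_right fun _ hB => h _ _ hA hB) a

lemma map (F : D ⥤ D) [F.CommShift ℤ] [F.IsTriangulated] (h : ∀ A, Q A → R (F.obj A)) {X : D}
    (hX : FilteredBy Q X) : FilteredBy R (F.obj X) := by
  induction hX with
  | zero X hX => exact zero _ (F.map_isZero hX)
  | extension T hT _ h₃ ih => exact extension _ (F.map_distinguished T hT) ih (h _ h₃)
  | of_iso X Y e _ ih => exact of_iso _ _ (F.mapIso e) ih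

lemma shift (n : ℤ) (h : ∀ A, Q A → R (A⟦n⟧)) {X : D} (hX : FilteredBy Q X) :
    FilteredBy R (X⟦n⟧) := by
  induction hX with
  | zero X hX => exact zero _ ((shiftFunctor D n).map_isZero hX)
  | extension T hT _ h₃ ih => exact extension _ (Triangle.shift_distinguished T hT n) ih (h _ h₃)
  | of_iso X Y e _ ih => exact of_iso _ _ ((shiftFunctor D n).mapIso e) ih

lemma of_sequence {m : ℕ} {X : Fin (m + 1) → D} {A : Fin m → D} (h0 : IsZero (X 0))
    (h : ∀ i, Q (A i) ∧ ∃ (a : X i.castSucc ⟶ X i.succ) (b : X i.succ ⟶ A i)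
      (c : A i ⟶ (X i.castSucc)⟦(1 : ℤ)⟧), Triangle.mk a b c ∈ (distTriang D))
    (i : Fin (m + 1)) : FilteredBy Q (X i) := by
  induction i using Fin.induction with
  | zero => exact zero _ h0
  | succ i ih =>
    obtain ⟨hA, a, b, c, hT⟩ := h i
    exact extension _ hT ih hA

end FilteredBy

/-! ### Split generators -/

lemma IsSplitGenerator.exists_filteredBy {G : D} (hG : IsSplitGenerator G) (E : D) :
    ∃ E' : D, FilteredBy (fun A => ∃ n : ℤ, A = G⟦n⟧) (E ⊞ E') := by
  by_cases hE : IsZero E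
  -- For zero `E` the complexity is `0` by convention and yields no tower.
  · refine ⟨E, .zero _ ?_⟩
    rw [IsZero.iff_id_eq_zero]
    ext <;> exact hE.eq_of_src _ _
  · have h := hG E 0
    rw [complexity, if_neg hE, sInf_lt_iff] at h
    obtain ⟨_, ⟨m, n, A, E', hA, ⟨e⟩, rfl⟩, -⟩ := h
    exact ⟨E', .of_iso _ _ e (.of_sequence hA.1 (fun i => ⟨⟨n i, rfl⟩, hA.2 i⟩) _)⟩

/-- `X` is a summand of an object built from shifts of `G`, so the projection onto `X` vanishes, and
with it the identity. -/
lemma IsSplitGenerator.isZero_of_hom_eq_zero {G : D} (hG : IsSplitGenerator G) {X : D}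
    (h : ∀ (n : ℤ) (a : G⟦n⟧ ⟶ X), a = 0) : IsZero X := by
  obtain ⟨E', hE'⟩ := hG.exists_filteredBy X
  have h0 : (biprod.fst : X ⊞ E' ⟶ X) = 0 :=
    hE'.hom_eq_zero_of_left (by rintro _ ⟨n, rfl⟩; exact h n) _
  rw [IsZero.iff_id_eq_zero, ← biprod.inl_fst (X := X) (Y := E'), h0, comp_zero]

lemma IsSplitGenerator.extDegrees_nonempty {G : D} (hG : IsSplitGenerator G) {X : D}
    (hX : ¬ IsZero X) : (extDegrees G X).Nonempty := by
  by_contra hempty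
  refine hX (hG.isZero_of_hom_eq_zero fun n a => ?_)
  by_contra ha
  refine hempty ⟨n, (shiftFunctorCompIsoId D n (-n) (by simp)).inv.app G ≫ a⟦-n⟧', fun h => ha ?_⟩
  exact (shiftFunctor D (-n)).map_injective ((cancel_epi _).1 (by rw [h]; simp))

/-! ### Phases -/

namespace StabilityCondition

variable {Γ : Type*} [AddCommGroup Γ] {cl : K0 D →+ Γ} (σ : StabilityCondition cl)

/-- The semistable objects with phase in `[a, b]`. -/
def phaseIn (a b : ℝ) : ObjectProperty D := fun E => ∃ φ, a ≤ φ ∧ φ ≤ b ∧ σ.P φ E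

lemma P_shift_one_iff (φ : ℝ) (E : D) : σ.P (φ + 1) (E⟦(1 : ℤ)⟧) ↔ σ.P φ E := by
  have := σ.closedUnderIso φ
  rw [σ.shift, ObjectProperty.prop_map_iff]
  refine ⟨?_, fun h => ⟨E, h, ⟨Iso.refl _⟩⟩⟩
  rintro ⟨E', hE', ⟨e⟩⟩
  exact (σ.P φ).prop_of_iso ((shiftFunctor D (1 : ℤ)).preimageIso e) hE'

lemma P_shift (φ : ℝ) (E : D) (n : ℤ) (h : σ.P φ E) : σ.P (φ + n) (E⟦n⟧) := by
  have := σ.closedUnderIso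
  have step : ∀ n : ℤ, σ.P (φ + (n + 1 : ℤ)) (E⟦n + 1⟧) ↔ σ.P (φ + n) (E⟦n⟧) := fun n => by
    rw [← σ.P_shift_one_iff (φ + n), Int.cast_add, Int.cast_one, ← add_assoc]
    exact (σ.P (φ + n + 1)).prop_iff_of_iso ((shiftFunctorAdd D n 1).app E)
  induction n using Int.induction_on with
  | zero =>
    simpa using (σ.P φ).prop_of_iso ((shiftFunctorZero D ℤ).symm.app E) h
  | succ n ih => exact (step n).2 ih
  | pred n ih => exact (step _).1 (by simpa using ih)

lemma exists_filteredBy_phaseIn (E : D) : ∃ a b : ℤ, FilteredBy (σ.phaseIn a b) E := by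
  obtain ⟨n, X, A, φ, h0, ⟨e⟩, -, h⟩ := σ.harderNarasimhan E
  obtain ⟨b, hb⟩ := (Set.finite_range φ).bddAbove
  obtain ⟨a, ha⟩ := (Set.finite_range φ).bddBelow
  -- The bounds are rounded to integers because `f` is known exactly only there.
  refine ⟨⌊a⌋, ⌈b⌉, .of_iso _ _ e (.of_sequence h0 (fun i => ⟨⟨φ i, ?_, ?_, (h i).1⟩, (h i).2⟩) _)⟩
  · exact (Int.floor_le a).trans (ha ⟨i, rfl⟩)
  · exact (hb ⟨i, rfl⟩).trans (Int.le_ceil b)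

variable {σ}

lemma filteredBy_shift {a b : ℝ} {E : D} (h : FilteredBy (σ.phaseIn a b) E) (n : ℤ) :
    FilteredBy (σ.phaseIn (a + n) (b + n)) (E⟦n⟧) := by
  refine h.shift n ?_
  rintro A ⟨φ, h₁, h₂, hA⟩
  exact ⟨φ + n, by linarith, by linarith, σ.P_shift φ A n hA⟩

lemma hom_eq_zero_of_filteredBy {a b a' b' : ℝ} {X Y : D} (hX : FilteredBy (σ.phaseIn a b) X)
    (hY : FilteredBy (σ.phaseIn a' b') Y) (h : b' < a) (x : X ⟶ Y) : x = 0 := by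
  refine hX.hom_eq_zero hY ?_ x
  rintro A B ⟨φ, h₁, -, hA⟩ ⟨ψ, -, h₂, hB⟩
  exact σ.hom_eq_zero φ ψ A B hA hB (by linarith)

/-- Monotonicity of `f` and its exact values at integers move the window by `m` at each step, so its
width does not grow with `n`. -/
lemma filteredBy_iterate (F : D ⥤ D) [F.CommShift ℤ] [F.IsTriangulated] (f : CircleDeg1Lift)
    {m : ℤ} (hm : f 0 = m) (hF : ∀ φ E, σ.P φ E → σ.P (f φ) (F.obj E)) {a b : ℤ} {E : D}
    (h : FilteredBy (σ.phaseIn a b) E) (n : ℕ) :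
    FilteredBy (σ.phaseIn (a + n * m) (b + n * m)) (F.obj^[n] E) := by
  induction n with
  | zero => simpa using h
  | succ n ih =>
    rw [Function.iterate_succ_apply']
    have hf : ∀ c : ℤ, f (c + n * m) = c + (n + 1 : ℕ) * m := fun c => by
      have := f.map_add_int 0 (c + n * m)
      push_cast at this ⊢
      rw [zero_add, hm] at this
      rw [this]
      ring
    refine ih.map F ?_
    rintro A ⟨φ, h₁, h₂, hA⟩
    exact ⟨f φ, (hf a).symm.le.trans (f.monotone h₁), (f.monotone h₂).trans (hf b).le, hF φ A hA⟩

end StabilityCondition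

/-! ### Consequences of the pseudo-Anosov condition, and the theorem. -/

lemma IsPseudoAnosovVia.P_map {Γ : Type*} [AddCommGroup Γ] {cl : K0 D →+ Γ} {F : D ≌ D}
    [F.functor.CommShift ℤ] [F.inverse.CommShift ℤ] [F.CommShift ℤ] [F.IsTriangulated]
    {σ : StabilityCondition cl} {g : GLTilde} (h : IsPseudoAnosovVia F σ g) (φ : ℝ) (E : D)
    (hE : σ.P φ E) : σ.P (g.f φ) (F.functor.obj E) := by
  have := congrFun (congrArg ChargeAndSlices.P h.act_eq) φ
  change (σ.P φ).map F.functor = σ.P (g.f φ) at this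
  rw [← this]
  exact (σ.P φ).prop_map_obj F.functor hE

/-- `T` sends `(1, 0)` to a multiple of itself, so the second coordinate of compatibility at `φ = 0`
gives `sin (π f(0)) = 0`. -/
lemma GLTilde.f_zero_mem_int (g : GLTilde)
    (h : IsHyperbolicDiagonal ((g.T : GL (Fin 2) ℝ) : Matrix (Fin 2) (Fin 2) ℝ)) :
    ∃ m : ℤ, g.f 0 = m := by
  obtain ⟨c, hc, hcompat⟩ := g.compat 0
  have h1 := congrFun hcompat 1
  have hsin : Real.sin (Real.pi * g.f 0) = 0 := by
    obtain ⟨r, -, hT | hT⟩ := h <;> rw [hT] at h1 <;>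
      simpa [Matrix.mulVec, dotProduct, hc.ne'] using h1
  obtain ⟨m, hm⟩ := Real.sin_eq_zero_iff.1 hsin
  exact ⟨m, mul_left_cancel₀ Real.pi_ne_zero (by rw [← hm, mul_comm])⟩

lemma not_isZero_iterate (F : D ≌ D) (hF : ¬ IsVirtuallyZero F.functor) {G : D}
    (hG : IsSplitGenerator G) [F.functor.Additive] (n : ℕ) : ¬ IsZero (F.functor.obj^[n] G) := by
  induction n with
  | zero =>
    intro h
    -- If `G` were zero, every object would be, so already the zeroth power of `F` would vanish.
    refine hF ⟨0, fun X => hG.isZero_of_hom_eq_zero fun n a => ?_⟩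
    exact ((shiftFunctor D n).map_isZero h).eq_of_src _ _
  | succ n ih =>
    rw [Function.iterate_succ_apply']
    intro h
    refine ih ((IsZero.iff_id_eq_zero _).2 (F.functor.map_injective ?_))
    exact h.eq_of_src _ _

end ShiftingNumbers

theorem mainTheorem11
    {k : Type w} [Field k]
    {D : Type u} [Category.{v} D] [Preadditive D] [Linear k D] [HasZeroObject D] [HasShift D ℤ]
    [∀ n : ℤ, (shiftFunctor D n).Additive] [∀ n : ℤ, (shiftFunctor D n).Linear k]
    [Pretriangulated D] [IsTriangulated D]
    (hfin : ShiftingNumbers.IsFiniteType k D) (hsat : ShiftingNumbers.IsSaturated k D)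
    (G : D) (hG : ShiftingNumbers.IsSplitGenerator G)
    {Γ : Type z} [AddCommGroup Γ] [Module.Free ℤ Γ] [Module.Finite ℤ Γ]
    (cl : ShiftingNumbers.K0 D →+ Γ)
    (F : D ≌ D) [F.functor.CommShift ℤ] [F.inverse.CommShift ℤ] [F.CommShift ℤ]
    [F.IsTriangulated] [F.functor.Linear k]
    (hF : ¬ ShiftingNumbers.IsVirtuallyZero F.functor)
    (σ : ShiftingNumbers.StabilityCondition cl) (g : ShiftingNumbers.GLTilde)
    (hpA : ShiftingNumbers.IsPseudoAnosovVia F σ g) :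
    ShiftingNumbers.HasUpperShiftingNumber F.functor G g.f.translationNumber ∧
      ShiftingNumbers.HasLowerShiftingNumber F.functor G g.f.translationNumber ∧
      ShiftingNumbers.HasShiftingNumber F.functor G g.f.translationNumber ∧
      g.f.translationNumber = g.f 0 ∧
      ∃ m : ℤ, g.f 0 = m := by
  obtain ⟨m, hm⟩ := g.f_zero_mem_int hpA.hyperbolic
  have hτ : g.f.translationNumber = m :=
    g.f.translationNumber_of_eq_add_int (by rw [hm, zero_add])
  obtain ⟨S, hS⟩ := hsat.exists_serre_dual hfin G
  obtain ⟨a, b, hGab⟩ := σ.exists_filteredBy_phaseIn G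
  obtain ⟨a', b', hSab⟩ := σ.exists_filteredBy_phaseIn S
  have hmain := ShiftingNumbers.hasShiftingNumbers_of_extDegrees_subset F.functor G (m := m)
    (C := max (b - a) (b' - a))
    (fun n => hG.extDegrees_nonempty (ShiftingNumbers.not_isZero_iterate F hF hG n)) (by
      rintro n j ⟨x, hx⟩
      have hX := ShiftingNumbers.StabilityCondition.filteredBy_shift
        (ShiftingNumbers.StabilityCondition.filteredBy_iterate F.functor g.f hm hpA.P_map
          hGab n) (-j)
      have h₁ : j - n * m ≤ b - a := by
        by_contra! hlt
        refine hx (ShiftingNumbers.StabilityCondition.hom_eq_zero_of_filteredBy hGab hX ?_ x)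
        have : ((b - a : ℤ) : ℝ) < (j - n * m : ℤ) := by exact_mod_cast hlt
        push_cast at this ⊢
        linarith
      -- Otherwise the phases of `Fⁿ G[-j]` all exceed those of `S`, so no nonzero map to `S`
      -- exists.
      have h₂ : -(b' - a) ≤ j - n * m := by
        by_contra! hlt
        refine hx (hS _ (ShiftingNumbers.StabilityCondition.hom_eq_zero_of_filteredBy hX hSab
          ?_) x)
        have : ((j - n * m : ℤ) : ℝ) < (-(b' - a) : ℤ) := by exact_mod_cast hlt
        push_cast at this ⊢
        linarith
      rw [abs_le]
      constructor
      · linarith [le_max_right (b - a) (b' - a)]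
      · exact h₁.trans (le_max_left _ _))
  rw [hτ]
  exact ⟨hmain.1, hmain.2, ⟨m, m, hmain.1, hmain.2, by ring⟩, hm.symm, m, hm⟩
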